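/- Let $d\in\mathbb{N}$, let $\mathcal{P}_2(\mathbb{R}^d)$ be the set of Borel probability measures on $\mathbb{R}^d$ with finite second moment, and let $f:\mathcal{P}_2(\mathbb{R}^d)\to\mathbb{R}$ and $\mu\in\mathcal{P}_2(\mathbb{R}^d)$. For a probability space $(\Omega,\mathcal{A},\mathbb{P})$ the lift of $f$ is the function $F_\Omega:L^2(\Omega,\mathbb{P};\mathbb{R}^d)\to\mathbb{R}$, $F_\Omega(X)=f(\mathcal{L}(X))$, where $\mathcal{L}(X)$ is the law of $X$; $f$ is called $L_\Omega$-differentiable at $\mu$ if there exists $X\in L^2(\Omega,\mathbb{P};\mathbb{R}^d)$ with $\mathcal{L}(X)=\mu$ such that $F_\Omega$ is Fréchet differentiable at $X$. When $F_\Omega$ is Fréchet differentiable at $X$, $DF_\Omega(X)$ denotes the element of $L^2(\Omega,\mathbb{P};\mathbb{R}^d)$ such that the differential of $F_\Omega$ at $X$ is $Y\mapsto\mathbb{E}[DF_\Omega(X)\cdot Y]$. Let $(\Omega,\mathcal{A},\mathbb{P})$ and $(\tilde\Omega,\tilde{\mathcal{A}},\tilde{\mathbb{P}})$ be two atomless probability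 spaces, i.e. every event of positive probability contains an event of strictly smaller positive probability. Then $f$ is $L_\Omega$-differentiable at $\mu$ if and only if it is $L_{\tilde\Omega}$-differentiable at $\mu$. Moreover, in this case, there is a single function $g\in L^2(\mathbb{R}^d,\mu;\mathbb{R}^d)$ such that, for every $X\in L^2(\Omega,\mathbb{P};\mathbb{R}^d)$ with law $\mu$, $F_\Omega$ is Fréchet differentiable at $X$ with $DF_\Omega(X)=g(X)$ $\mathbb{P}$-almost surely, and, for every $\tilde X\in L^2(\tilde\Omega,\tilde{\mathbb{P}};\mathbb{R}^d)$ with law $\mu$, $F_{\tilde\Omega}$ is Fréchet differentiable at $\tilde X$ with $DF_{\tilde\Omega}(\tilde X)=g(\tilde X)$ $\tilde{\mathbb{P}}$-almost surely. -/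

import Mathlib

open MeasureTheory
open scoped ENNReal

noncomputable section

/-- A finite measure `P` is atomless: every measurable set of positive measure has a measurable
subset whose measure is positive and strictly smaller. This concerns all measurable sets,
not just singletons. -/
def IsAtomless {Ω : Type*} [MeasurableSpace Ω] (P : Measure Ω) : Prop :=
  ∀ A : Set Ω, MeasurableSet A → 0 < P A →
    ∃ B : Set Ω, B ⊆ A ∧ MeasurableSet B ∧ 0 < P B ∧ P B < P A

/-- `𝒫₂(ℝᵈ)`: Borel probability measures on `ℝᵈ` with finite second moment. -/
def P2 (d : ℕ) : Type :=
  {μ : Measure (EuclideanSpace ℝ (Fin d)) //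
    IsProbabilityMeasure μ ∧ ∫⁻ x, ‖x‖ₑ ^ 2 ∂μ < ∞}

/-- `L²(Ω, P; ℝᵈ)`, a Hilbert space of almost sure equivalence classes. -/
abbrev L2 {Ω : Type*} [MeasurableSpace Ω] (P : Measure Ω) (d : ℕ) : Type _ :=
  Lp (EuclideanSpace ℝ (Fin d)) 2 P

section Lift

variable {Ω : Type*} [MeasurableSpace Ω] {d : ℕ}

theorem L2.measurable {P : Measure Ω} (X : L2 P d) : Measurable X :=
  (Lp.stronglyMeasurable X).measurable

theorem L2.lintegral_sq_map_lt_top {P : Measure Ω} (X : L2 P d) :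
    ∫⁻ x, ‖x‖ₑ ^ 2 ∂(P.map X) < ∞ := by
  rw [lintegral_map (by fun_prop) X.measurable]
  have h := (Lp.memLp X).2
  rw [eLpNorm_lt_top_iff_lintegral_rpow_enorm_lt_top (by norm_num) (by norm_num)] at h
  simpa using h

/-- The law of `X ∈ L²(Ω, P; ℝᵈ)`, as an element of `𝒫₂(ℝᵈ)`. -/
def law (P : Measure Ω) [IsProbabilityMeasure P] (X : L2 P d) : P2 d :=
  ⟨P.map X, Measure.isProbabilityMeasure_map X.measurable.aemeasurable,
    X.lintegral_sq_map_lt_top⟩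

theorem measurePreserving_of_law_eq {P : Measure Ω} [IsProbabilityMeasure P] {X : L2 P d}
    {μ : P2 d} (h : law P X = μ) : MeasurePreserving X P μ.1 :=
  ⟨X.measurable, congrArg Subtype.val h⟩

/-- The lift of `f : 𝒫₂(ℝᵈ) → ℝ` to `L²(Ω, P; ℝᵈ)`. -/
def lift (P : Measure Ω) [IsProbabilityMeasure P] (f : P2 d → ℝ) (X : L2 P d) : ℝ :=
  f (law P X)

/-- `f` is `L_Ω`-differentiable at `μ`: its lift is Fréchet differentiable at some `X ∼ μ`. -/
def LDifferentiableAt (P : Measure Ω) [IsProbabilityMeasure P] (f : P2 d → ℝ) (μ : P2 d) : Prop :=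
  ∃ X : L2 P d, law P X = μ ∧ DifferentiableAt ℝ (lift P f) X

/-- `g ∈ L²(ℝᵈ, μ; ℝᵈ)` represents the Fréchet derivatives of the lift of `f` above `μ`:
at every `X ∼ μ` in `L²(Ω, P; ℝᵈ)` the lift is Fréchet differentiable, with derivative
`Y ↦ E[g(X) · Y]`. -/
def IsLDerivativeAt (P : Measure Ω) [IsProbabilityMeasure P] (f : P2 d → ℝ) (μ : P2 d)
    (g : L2 μ.1 d) : Prop :=
  ∀ (X : L2 P d) (hX : law P X = μ),
    HasGradientAt (lift P f)
      (Lp.compMeasurePreserving X (measurePreserving_of_law_eq hX) g) X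

end Lift

end

/-! The lift sees only laws, so a gradient `ξ` at `X` should be a gradient at any `X'` paired with
`ξ'` such that `(X', ξ') ∼ (X, ξ)`. To test this against `Y'`, one wants `Y` with `(X, ξ, Y) ∼ (X',
ξ', Y')`. Such a `Y` may fail to exist, for instance when `X` generates the σ-algebra. After
rounding `(X, ξ)` to countably many values it does exist, because every event of positive
probability in an atomless space carries all laws. The rounding error tends to zero
(`IsAtomless.hasGradientAt_lift_of_identDistrib`).

Only the source space of this transfer has to be atomless. It may therefore be applied to a target
carrying `X` and two conditionally independent copies of `ξ` given `X`. Both copies are gradients at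
the same point, hence equal, and this forces `ξ = g(X)` (`IsAtomless.exists_gradient_lift_eq_comp`).
The law of `(X, g(X))` depends only on `μ` and `g`, so a second transfer reaches every variable of
law `μ` on either space. -/

open ProbabilityTheory Filter Topology

/-! ### Diffuse random variables on atomless spaces -/

section Atomless

variable {Ω : Type*} [MeasurableSpace Ω] {P : Measure Ω}

/-- In an atomless finite measure space every event of positive measure has a subset of
arbitrarily small positive measure. -/
theorem IsAtomless.exists_subset_measure_le [IsFiniteMeasure P] (hP : IsAtomless P)
    {ε : ℝ≥0∞} (hε : 0 < ε) {A : Set Ω} (hA : MeasurableSet A) (hA0 : 0 < P A) :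
    ∃ B ⊆ A, MeasurableSet B ∧ 0 < P B ∧ P B ≤ ε := by
  have half : ∀ A : Set Ω, MeasurableSet A → 0 < P A →
      ∃ B ⊆ A, MeasurableSet B ∧ 0 < P B ∧ P B ≤ P A / 2 := by
    intro A hA hA0
    obtain ⟨B, hBA, hB, hB0, hlt⟩ := hP A hA hA0
    have hadd : P B + P (A \ B) = P A := by
      rw [← measure_inter_add_sdiff A hB, Set.inter_eq_self_of_subset_right hBA]
    rcases le_total (P B) (P A / 2) with h | h
    · exact ⟨B, hBA, hB, hB0, h⟩
    -- Of `B` and `A \ B`, one has at most half the measure of `A`.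
    · refine ⟨A \ B, Set.sdiff_subset, hA.diff hB, ?_, ?_⟩
      · rw [pos_iff_ne_zero]
        intro h0
        rw [h0, add_zero] at hadd
        exact hlt.ne hadd
      · have h1 : P A / 2 + P (A \ B) ≤ P A / 2 + P A / 2 := by
          rw [ENNReal.add_halves, ← hadd]
          gcongr
          rwa [hadd]
        exact (ENNReal.add_le_add_iff_left
          (ENNReal.div_ne_top (measure_ne_top P A) (by norm_num))).1 h1
  have iter : ∀ n : ℕ, ∃ B ⊆ A, MeasurableSet B ∧ 0 < P B ∧ P B ≤ P A * 2⁻¹ ^ n := by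
    intro n
    induction n with
    | zero => exact ⟨A, subset_rfl, hA, hA0, by simp⟩
    | succ n ih =>
      obtain ⟨B, hBA, hB, hB0, hle⟩ := ih
      obtain ⟨C, hCB, hC, hC0, hC'⟩ := half B hB hB0
      refine ⟨C, hCB.trans hBA, hC, hC0, hC'.trans ?_⟩
      rw [pow_succ, ← mul_assoc, div_eq_mul_inv]
      gcongr
  have hlim : Tendsto (fun n : ℕ ↦ P A * (2⁻¹ : ℝ≥0∞) ^ n) atTop (𝓝 0) := by
    have := ENNReal.Tendsto.const_mul (a := P A)
      (ENNReal.tendsto_pow_atTop_nhds_zero_of_lt_one (r := 2⁻¹) (by simp))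
      (Or.inr (measure_ne_top P A))
    simpa using this
  obtain ⟨n, hn⟩ := (hlim.eventually (ge_mem_nhds hε)).exists
  obtain ⟨B, hBA, hB, hB0, hle⟩ := iter n
  exact ⟨B, hBA, hB, hB0, hle.trans hn⟩

/-- An atomless finite measure space is covered, up to a null set, by countably many events of
small measure. -/
theorem IsAtomless.exists_countable_cover [IsFiniteMeasure P] (hP : IsAtomless P)
    {ε : ℝ≥0∞} (hε : 0 < ε) :
    ∃ C : Set (Set Ω), C.Countable ∧ (∀ s ∈ C, MeasurableSet s ∧ P s ≤ ε) ∧ P (⋃₀ C)ᶜ = 0 := by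
  -- Exhaustion: the supremum of the covered mass over countable families is attained by a countable
  -- union, and a non-null remainder would contain a further small set.
  let 𝒞 : Set (Set (Set Ω)) := {C | C.Countable ∧ ∀ s ∈ C, MeasurableSet s ∧ P s ≤ ε}
  have hmeas : ∀ C ∈ 𝒞, MeasurableSet (⋃₀ C) := fun C hC ↦
    MeasurableSet.sUnion hC.1 fun s hs ↦ (hC.2 s hs).1
  obtain ⟨u, -, hu, hmem⟩ := exists_seq_tendsto_sSup
    (S := (fun C ↦ P (⋃₀ C)) '' 𝒞) ⟨_, ∅, ⟨Set.countable_empty, by simp⟩, rfl⟩ (OrderTop.bddAbove _)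
  choose C hC hCu using hmem
  have hD : (⋃ n, C n) ∈ 𝒞 := by
    refine ⟨Set.countable_iUnion fun n ↦ (hC n).1, fun s hs ↦ ?_⟩
    obtain ⟨n, hn⟩ := Set.mem_iUnion.1 hs
    exact (hC n).2 s hn
  have hsup : ∀ C' ∈ 𝒞, P (⋃₀ C') ≤ P (⋃₀ ⋃ n, C n) := by
    intro C' hC'
    refine (le_sSup (Set.mem_image_of_mem _ hC')).trans (le_of_tendsto' hu fun n ↦ ?_)
    rw [← hCu n]
    exact measure_mono (Set.sUnion_subset_sUnion (Set.subset_iUnion C n))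
  refine ⟨⋃ n, C n, hD.1, hD.2, ?_⟩
  by_contra h0
  obtain ⟨B, hBA, hB, hB0, hle⟩ :=
    hP.exists_subset_measure_le hε (hmeas _ hD).compl (pos_iff_ne_zero.2 h0)
  have h1 := hsup (insert B (⋃ n, C n)) ⟨hD.1.insert B, by
    rintro s (rfl | hs)
    exacts [⟨hB, hle⟩, hD.2 s hs]⟩
  rw [Set.sUnion_insert, measure_union (Set.disjoint_left.2 fun x hx hx' ↦ hBA hx hx')
    (hmeas _ hD)] at h1
  have h2 : P B + P (⋃₀ ⋃ n, C n) ≤ 0 + P (⋃₀ ⋃ n, C n) := by rwa [zero_add]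
  exact hB0.not_ge ((ENNReal.add_le_add_iff_right (measure_ne_top P _)).1 h2)

/-- An atomless finite measure space has a countable measurable partition into events of small
measure. -/
theorem IsAtomless.exists_measurable_nat [IsFiniteMeasure P] (hP : IsAtomless P)
    {ε : ℝ≥0∞} (hε : 0 < ε) :
    ∃ q : Ω → ℕ, Measurable q ∧ ∀ k, P (q ⁻¹' {k}) ≤ ε := by
  classical
  obtain ⟨C, hC, hCε, hC0⟩ := hP.exists_countable_cover hε
  -- Adjoining the null remainder makes the cover total, so that the first index of a set containing
  -- `ω` is defined everywhere.
  obtain ⟨S, hS⟩ := (hC.insert (⋃₀ C)ᶜ).exists_eq_range (Set.insert_nonempty _ _)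
  have hSε : ∀ n, MeasurableSet (S n) ∧ P (S n) ≤ ε := by
    intro n
    have : S n ∈ insert (⋃₀ C)ᶜ C := hS ▸ Set.mem_range_self n
    rcases this with h | h
    · rw [h]
      exact ⟨(MeasurableSet.sUnion hC fun s hs ↦ (hCε s hs).1).compl, hC0.trans_le zero_le⟩
    · exact hCε _ h
  have hcov : ∀ ω, ∃ n, ω ∈ S n := by
    intro ω
    by_cases h : ω ∈ ⋃₀ C
    · obtain ⟨s, hs, hω⟩ := h
      obtain ⟨n, rfl⟩ := hS ▸ Set.mem_insert_of_mem (⋃₀ C)ᶜ hs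
      exact ⟨n, hω⟩
    · obtain ⟨n, hn⟩ := hS ▸ Set.mem_insert (⋃₀ C)ᶜ C
      exact ⟨n, hn ▸ h⟩
  refine ⟨fun ω ↦ Nat.find (hcov ω), measurable_find hcov fun n ↦ (hSε n).1, fun k ↦ ?_⟩
  refine (measure_mono ?_).trans (hSε k).2
  rintro ω rfl
  exact Nat.find_spec (hcov ω)

/-- An atomless finite measure space carries a real random variable with diffuse law. -/
theorem IsAtomless.exists_measurable_real [IsFiniteMeasure P] (hP : IsAtomless P) :
    ∃ U : Ω → ℝ, Measurable U ∧ ∀ u, P (U ⁻¹' {u}) = 0 := by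
  choose q hq hqε using fun n : ℕ ↦
    hP.exists_measurable_nat (ε := ((n : ℝ≥0∞) + 1)⁻¹) (by simp)
  have he := measurableEmbedding_embeddingReal (ℕ → ℕ)
  refine ⟨fun ω ↦ embeddingReal (ℕ → ℕ) fun n ↦ q n ω,
    he.measurable.comp (measurable_pi_lambda _ hq), fun u ↦ ?_⟩
  have hlim : Tendsto (fun n : ℕ ↦ ((n : ℝ≥0∞) + 1)⁻¹) atTop (𝓝 0) := by
    have := (tendsto_add_atTop_iff_nat 1).2 ENNReal.tendsto_inv_nat_nhds_zero
    simpa using this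
  -- By injectivity of the coding, a fibre lies in one cell of every partition, and the cell sizes
  -- tend to zero.
  by_cases hu : ∃ a, embeddingReal (ℕ → ℕ) a = u
  · obtain ⟨a, rfl⟩ := hu
    refine le_antisymm (ge_of_tendsto' hlim fun n ↦ (measure_mono ?_).trans (hqε n (a n))) zero_le
    intro ω hω
    exact congrFun (he.injective hω) n
  · convert measure_empty (μ := P)
    ext ω
    simp only [Set.mem_preimage, Set.mem_singleton_iff, Set.mem_empty_iff_false, iff_false]
    exact fun h ↦ hu ⟨_, h⟩

end Atomless

/-! ### Realising prescribed laws -/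

section Realisation

variable {Ω : Type*} [MeasurableSpace Ω]

theorem continuous_cdf_of_measure_singleton_eq_zero (ν : Measure ℝ) [IsProbabilityMeasure ν]
    (h : ∀ u, ν {u} = 0) : Continuous (cdf ν) := by
  refine continuous_iff_continuousAt.2 fun x ↦ ?_
  rw [(cdf ν).mono.continuousAt_iff_leftLim_eq_rightLim, (cdf ν).rightLim_eq]
  have h1 := (cdf ν).measure_singleton x
  rw [measure_cdf, h x, eq_comm, ENNReal.ofReal_eq_zero] at h1
  exact le_antisymm ((cdf ν).mono.leftLim_le le_rfl) (by linarith)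

/-- Probability integral transform. -/
theorem exists_map_eq_volume_unitInterval (m : Measure Ω) [IsProbabilityMeasure m] {U : Ω → ℝ}
    (hU : Measurable U) (hU0 : ∀ u, m (U ⁻¹' {u}) = 0) :
    ∃ V : Ω → unitInterval, Measurable V ∧ m.map V = volume := by
  have := Measure.isProbabilityMeasure_map (μ := m) hU.aemeasurable
  set F := cdf (m.map U) with hF
  have hcont : Continuous F := continuous_cdf_of_measure_singleton_eq_zero _ fun u ↦ by
    rw [Measure.map_apply hU (measurableSet_singleton u), hU0]
  have hV : Measurable fun ω ↦ (⟨F (U ω), cdf_nonneg _ _, cdf_le_one _ _⟩ : unitInterval) :=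
    (hcont.measurable.comp hU).subtype_mk
  -- The values 0 and 1 need not be attained by `F`. The strict inequality on the left avoids
  -- discussing intervals where `F` is constant; it is removed below by letting `s` decrease to `t`.
  have key : ∀ t : ℝ, 0 < t → t < 1 →
      m {ω | F (U ω) < t} ≤ ENNReal.ofReal t ∧ ENNReal.ofReal t ≤ m {ω | F (U ω) ≤ t} := by
    intro t h0 h1
    obtain ⟨x, hx⟩ : ∃ x, F x = t := by
      obtain ⟨a, ha⟩ := ((tendsto_cdf_atBot (m.map U)).eventually (gt_mem_nhds h0)).exists
      obtain ⟨b, hb⟩ := ((tendsto_cdf_atTop (m.map U)).eventually (lt_mem_nhds h1)).exists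
      exact mem_range_of_exists_le_of_exists_ge hcont ⟨a, ha.le⟩ ⟨b, hb.le⟩
    have hm : m {ω | U ω ≤ x} = ENNReal.ofReal t := by
      rw [← hx, hF, ofReal_cdf, Measure.map_apply hU measurableSet_Iic]
      rfl
    rw [← hm]
    constructor
    · refine measure_mono fun ω (hω : F (U ω) < t) ↦ ?_
      by_contra hlt
      exact hω.not_ge (hx ▸ F.mono (not_le.1 hlt).le)
    · exact measure_mono fun ω (hω : U ω ≤ x) ↦ (F.mono hω).trans hx.le
  refine ⟨_, hV, ?_⟩
  have := Measure.isProbabilityMeasure_map (μ := m) hV.aemeasurable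
  refine Measure.ext_of_Iic _ _ fun t ↦ ?_
  rw [unitInterval.volume_Iic, Measure.map_apply hV measurableSet_Iic]
  change m {ω | F (U ω) ≤ t} = _
  rcases eq_or_lt_of_le t.2.2 with h1 | h1
  · rw [h1, ENNReal.ofReal_one]
    convert measure_univ (μ := m)
    exact Set.eq_univ_of_forall fun ω ↦ cdf_le_one _ _
  refine le_antisymm ?_ ?_
  · have hlim : Tendsto (fun s : ℝ ↦ ENNReal.ofReal s) (𝓝[>] (t : ℝ)) (𝓝 (ENNReal.ofReal t)) :=
      (ENNReal.continuous_ofReal.tendsto _).mono_left nhdsWithin_le_nhds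
    refine ge_of_tendsto hlim ?_
    filter_upwards [Ioo_mem_nhdsGT h1] with s hs
    exact (measure_mono fun ω (hω : F (U ω) ≤ t) ↦ hω.trans_lt hs.1).trans
      (key s (t.2.1.trans_lt hs.1) hs.2).1
  · rcases eq_or_lt_of_le t.2.1 with h0 | h0
    · simp [← h0]
    · exact (key t h0 h1).2

/-- A probability space with a diffuse real random variable carries every law on a standard Borel
space. -/
theorem exists_measurable_map_eq_of_measure_preimage_singleton_eq_zero
    (m : Measure Ω) [IsProbabilityMeasure m] {U : Ω → ℝ}
    (hU : Measurable U) (hU0 : ∀ u, m (U ⁻¹' {u}) = 0)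
    {E : Type*} [MeasurableSpace E] [StandardBorelSpace E] [Nonempty E]
    (ν : Measure E) [IsProbabilityMeasure ν] :
    ∃ Y : Ω → E, Measurable Y ∧ m.map Y = ν := by
  obtain ⟨V, hV, hVm⟩ := exists_map_eq_volume_unitInterval m hU hU0
  obtain ⟨φ, hφ, hφν⟩ := (Kernel.const Unit ν).exists_measurable_map_eq_unitInterval
  have hφ' : Measurable (φ ()) := hφ.of_uncurry_left
  refine ⟨φ () ∘ V, hφ'.comp hV, ?_⟩
  rw [← Measure.map_map hφ' hV, hVm, hφν, Kernel.const_apply]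

theorem measure_eq_tsum_preimage_inter (Q : Measure Ω) {M : Ω → ℕ} (hM : Measurable M) {A : Set Ω}
    (hA : MeasurableSet A) : Q A = ∑' k, Q (M ⁻¹' {k} ∩ A) := by
  rw [← measure_iUnion]
  · congr 1
    ext ω
    simp
  · intro i j hij
    refine Set.disjoint_left.2 fun ω hi hj ↦ hij ?_
    exact (hi.1 : M ω = i).symm.trans hj.1
  · exact fun k ↦ (hM (measurableSet_singleton k)).inter hA

/-- On an atomless probability space, a discrete random variable `N` can be completed to a copy of
any pair `(N', Y')` with `N' ∼ N`. -/
theorem IsAtomless.exists_identDistrib_prodMk {P : Measure Ω} [IsProbabilityMeasure P]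
    (hP : IsAtomless P) {Ω' : Type*} [MeasurableSpace Ω'] {P' : Measure Ω'}
    [IsProbabilityMeasure P'] {E : Type*} [MeasurableSpace E] [StandardBorelSpace E] [Nonempty E]
    {N : Ω → ℕ} (hN : Measurable N) {N' : Ω' → ℕ} (hN' : Measurable N')
    (hNN : P.map N = P'.map N') {Y' : Ω' → E} (hY' : Measurable Y') :
    ∃ Y : Ω → E, Measurable Y ∧
      P.map (fun ω ↦ (N ω, Y ω)) = P'.map (fun ω ↦ (N' ω, Y' ω)) := by
  obtain ⟨U, hU, hU0⟩ := hP.exists_measurable_real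
  have hk : ∀ k, MeasurableSet (N ⁻¹' {k}) := fun k ↦ hN (measurableSet_singleton k)
  have hk' : ∀ k, MeasurableSet (N' ⁻¹' {k}) := fun k ↦ hN' (measurableSet_singleton k)
  have hPN : ∀ k, P (N ⁻¹' {k}) = P' (N' ⁻¹' {k}) := fun k ↦ by
    rw [← Measure.map_apply hN (measurableSet_singleton k), hNN,
      Measure.map_apply hN' (measurableSet_singleton k)]
  have hex : ∀ k, ∃ Y : Ω → E, Measurable Y ∧ ∀ s, MeasurableSet s →
      P (N ⁻¹' {k} ∩ Y ⁻¹' s) = P' (N' ⁻¹' {k} ∩ Y' ⁻¹' s) := by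
    intro k
    by_cases h0 : P (N ⁻¹' {k}) = 0
    · refine ⟨fun _ ↦ Classical.arbitrary E, measurable_const, fun s _ ↦ ?_⟩
      rw [measure_inter_null_of_null_left _ h0,
        measure_inter_null_of_null_left _ ((hPN k).symm.trans h0)]
    · have h0' : P' (N' ⁻¹' {k}) ≠ 0 := hPN k ▸ h0
      have := cond_isProbabilityMeasure h0
      have := cond_isProbabilityMeasure h0'
      have := Measure.isProbabilityMeasure_map (μ := P'[|N' ⁻¹' {k}]) hY'.aemeasurable
      -- `U` stays diffuse under conditioning, so each cell of `N` carries the conditional law of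
      -- `Y'` on the matching cell.
      obtain ⟨Y, hY, hYm⟩ := exists_measurable_map_eq_of_measure_preimage_singleton_eq_zero
        P[|N ⁻¹' {k}] hU (fun u ↦ cond_absolutelyContinuous (hU0 u)) ((P'[|N' ⁻¹' {k}]).map Y')
      refine ⟨Y, hY, fun s hs ↦ ?_⟩
      have h1 := congrArg (fun m ↦ m s) hYm
      simp only [Measure.map_apply hY hs, Measure.map_apply hY' hs, cond_apply (hk k),
        cond_apply (hk' k), hPN k] at h1
      exact (ENNReal.mul_right_inj (ENNReal.inv_ne_zero.2 (measure_ne_top _ _))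
        (ENNReal.inv_ne_top.2 h0')).1 h1
  choose Y hY hYm using hex
  have hglue : Measurable fun ω ↦ Y (N ω) ω := by
    have : Measurable fun p : ℕ × Ω ↦ Y p.1 p.2 := measurable_from_prod_countable_right hY
    exact this.comp (hN.prodMk measurable_id)
  refine ⟨fun ω ↦ Y (N ω) ω, hglue, ?_⟩
  have := Measure.isProbabilityMeasure_map (μ := P) (hN.prodMk hglue).aemeasurable
  refine Measure.ext_prod fun {s t} hs ht ↦ ?_
  rw [Measure.map_apply (hN.prodMk hglue) (hs.prod ht),
    Measure.map_apply (hN'.prodMk hY') (hs.prod ht)]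
  rw [measure_eq_tsum_preimage_inter P hN ((hN.prodMk hglue) (hs.prod ht)),
    measure_eq_tsum_preimage_inter P' hN' ((hN'.prodMk hY') (hs.prod ht))]
  refine tsum_congr fun k ↦ ?_
  by_cases hks : k ∈ s
  · convert hYm k t ht using 2
    · ext ω
      simp only [Set.mem_inter_iff, Set.mem_preimage, Set.mem_singleton_iff, Set.mem_prod]
      refine and_congr_right ?_
      rintro rfl
      simp [hks]
    · ext ω
      simp only [Set.mem_inter_iff, Set.mem_preimage, Set.mem_singleton_iff, Set.mem_prod]
      refine and_congr_right ?_
      rintro rfl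
      simp [hks]
  · convert (measure_empty (μ := P)).trans (measure_empty (μ := P')).symm using 2
    · refine Set.eq_empty_of_forall_notMem ?_
      rintro ω ⟨rfl, h, -⟩
      exact hks h
    · refine Set.eq_empty_of_forall_notMem ?_
      rintro ω ⟨rfl, h, -⟩
      exact hks h

end Realisation

/-! ### Transfer of gradients by approximate coupling -/

section Transfer

theorem exists_measurable_nat_dist_lt {W : Type*} [PseudoMetricSpace W]
    [TopologicalSpace.SeparableSpace W] [Nonempty W] [MeasurableSpace W] [OpensMeasurableSpace W]
    {η : ℝ} (hη : 0 < η) :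
    ∃ (r : W → ℕ) (c : ℕ → W), Measurable r ∧ ∀ w, dist w (c (r w)) < η := by
  classical
  have hex : ∀ w : W, ∃ n, dist w (TopologicalSpace.denseSeq W n) < η := fun w ↦
    (TopologicalSpace.denseRange_denseSeq W).exists_dist_lt w hη
  exact ⟨fun w ↦ Nat.find (hex w), TopologicalSpace.denseSeq W,
    measurable_find hex fun n ↦ measurableSet_lt (by fun_prop) measurable_const,
    fun w ↦ Nat.find_spec (hex w)⟩

variable {Ω : Type*} [MeasurableSpace Ω] {P : Measure Ω}
  {Ω' : Type*} [MeasurableSpace Ω'] {P' : Measure Ω'} {d : ℕ}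

theorem ProbabilityTheory.IdentDistrib.inner_toLp_eq {A B : Ω → EuclideanSpace ℝ (Fin d)}
    {A' B' : Ω' → EuclideanSpace ℝ (Fin d)}
    (h : IdentDistrib (fun ω ↦ (A ω, B ω)) (fun ω ↦ (A' ω, B' ω)) P P')
    (hA : MemLp A 2 P) (hB : MemLp B 2 P) (hA' : MemLp A' 2 P') (hB' : MemLp B' 2 P') :
    inner ℝ (hA.toLp A) (hB.toLp B) = inner ℝ (hA'.toLp A') (hB'.toLp B') := by
  rw [MeasureTheory.L2.inner_def, MeasureTheory.L2.inner_def]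
  have h1 : ∫ a, inner ℝ (hA.toLp A a) (hB.toLp B a) ∂P = ∫ a, inner ℝ (A a) (B a) ∂P := by
    refine integral_congr_ae ?_
    filter_upwards [hA.coeFn_toLp, hB.coeFn_toLp] with a h1 h2
    rw [h1, h2]
  have h2 : ∫ a, inner ℝ (hA'.toLp A' a) (hB'.toLp B' a) ∂P' = ∫ a, inner ℝ (A' a) (B' a) ∂P' := by
    refine integral_congr_ae ?_
    filter_upwards [hA'.coeFn_toLp, hB'.coeFn_toLp] with a h1 h2
    rw [h1, h2]
  rw [h1, h2]
  exact (h.comp (u := fun p : EuclideanSpace ℝ (Fin d) × EuclideanSpace ℝ (Fin d) ↦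
    inner ℝ p.1 p.2) (by fun_prop)).integral_eq

theorem ProbabilityTheory.IdentDistrib.norm_toLp_eq {A : Ω → EuclideanSpace ℝ (Fin d)}
    {A' : Ω' → EuclideanSpace ℝ (Fin d)} (h : IdentDistrib A A' P P')
    (hA : MemLp A 2 P) (hA' : MemLp A' 2 P') :
    ‖hA.toLp A‖ = ‖hA'.toLp A'‖ := by
  rw [Lp.norm_toLp, Lp.norm_toLp, h.eLpNorm_eq]

theorem exists_memLp_norm_sub_toLp_le [IsProbabilityMeasure P] (Z : L2 P d)
    {A : Ω → EuclideanSpace ℝ (Fin d)} (hA : Measurable A) {η : ℝ} (hη : 0 ≤ η)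
    (h : ∀ ω, ‖Z ω - A ω‖ ≤ η) : ∃ hA : MemLp A 2 P, ‖Z - hA.toLp A‖ ≤ η := by
  have h1 : MemLp (fun ω ↦ Z ω - A ω) 2 P :=
    MemLp.of_bound (Z.measurable.sub hA).aestronglyMeasurable η (Eventually.of_forall h)
  have h2 : MemLp A 2 P := by
    have := (Lp.memLp Z).sub h1
    exact this.ae_eq (Eventually.of_forall fun ω ↦ by simp)
  refine ⟨h2, ?_⟩
  have := Lp.norm_le_of_ae_bound (f := Z - h2.toLp A) hη (by
    filter_upwards [h2.coeFn_toLp, Lp.coeFn_sub Z (h2.toLp A)] with ω hω hω'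
    rw [hω', Pi.sub_apply, hω]
    exact h ω)
  have h3 : measureUnivNNReal P = 1 := by simp [measureUnivNNReal]
  rwa [h3, NNReal.coe_one, Real.one_rpow, one_mul] at this

/-- If `(X, ξ) ∼ (X', ξ')` and the first space is atomless, then every `Y'` on the second space has
a copy `Y` on the first one for which `‖Y - X‖` is at most slightly larger than
`‖Y' - X'‖` and `E[ξ · Y]` is as close as desired to `E[ξ' · Y']`. -/
theorem IsAtomless.exists_approx_coupling [IsProbabilityMeasure P] [IsProbabilityMeasure P']
    (hP : IsAtomless P) {X ξ : L2 P d} {X' ξ' : L2 P' d}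
    (h : IdentDistrib (fun ω ↦ (X ω, ξ ω)) (fun ω ↦ (X' ω, ξ' ω)) P P') (Y' : L2 P' d)
    {η : ℝ} (hη : 0 < η) :
    ∃ Y : L2 P d, law P Y = law P' Y' ∧ ‖Y - X‖ ≤ ‖Y' - X'‖ + 2 * η ∧
      |inner ℝ ξ Y - inner ℝ ξ' Y'| ≤ 2 * η * ‖Y'‖ := by
  obtain ⟨r, c, hr, hc⟩ := exists_measurable_nat_dist_lt
    (W := EuclideanSpace ℝ (Fin d) × EuclideanSpace ℝ (Fin d)) hη
  have hXξ : Measurable fun ω ↦ (X ω, ξ ω) := X.measurable.prodMk ξ.measurable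
  have hXξ' : Measurable fun ω ↦ (X' ω, ξ' ω) := X'.measurable.prodMk ξ'.measurable
  have hN := hr.comp hXξ
  have hN' := hr.comp hXξ'
  obtain ⟨Y, hY, hNY⟩ := hP.exists_identDistrib_prodMk hN hN' (h.comp hr).map_eq Y'.measurable
  have hid : IdentDistrib (fun ω ↦ (r (X ω, ξ ω), Y ω)) (fun ω ↦ (r (X' ω, ξ' ω), Y' ω)) P P' :=
    ⟨(hN.prodMk hY).aemeasurable, (hN'.prodMk Y'.measurable).aemeasurable, hNY⟩
  have hYY : IdentDistrib Y Y' P P' := hid.comp measurable_snd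
  have hYL : MemLp Y 2 P := hYY.symm.memLp_snd (Lp.memLp Y')
  -- The product distance is a maximum, so a single code `r` rounds both `X` and `ξ` within `η`.
  -- Each rounding is paid twice, once on each space, whence the factors 2.
  have hcell : ∀ w : EuclideanSpace ℝ (Fin d) × EuclideanSpace ℝ (Fin d),
      ‖w.1 - (c (r w)).1‖ ≤ η ∧ ‖w.2 - (c (r w)).2‖ ≤ η := fun w ↦ by
    have := (hc w).le
    rw [Prod.dist_eq, max_le_iff, dist_eq_norm, dist_eq_norm] at this
    exact this
  have hc1 : Measurable fun n ↦ (c n).1 := measurable_from_nat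
  have hc2 : Measurable fun n ↦ (c n).2 := measurable_from_nat
  obtain ⟨hA, hXA⟩ := exists_memLp_norm_sub_toLp_le X
    (A := fun ω ↦ (c (r (X ω, ξ ω))).1) (hc1.comp hN) hη.le fun ω ↦ (hcell (X ω, ξ ω)).1
  obtain ⟨hB, hξB⟩ := exists_memLp_norm_sub_toLp_le ξ
    (A := fun ω ↦ (c (r (X ω, ξ ω))).2) (hc2.comp hN) hη.le fun ω ↦ (hcell (X ω, ξ ω)).2
  obtain ⟨hA', hXA'⟩ := exists_memLp_norm_sub_toLp_le X'
    (A := fun ω ↦ (c (r (X' ω, ξ' ω))).1) (hc1.comp hN') hη.le fun ω ↦ (hcell (X' ω, ξ' ω)).1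
  obtain ⟨hB', hξB'⟩ := exists_memLp_norm_sub_toLp_le ξ'
    (A := fun ω ↦ (c (r (X' ω, ξ' ω))).2) (hc2.comp hN') hη.le fun ω ↦ (hcell (X' ω, ξ' ω)).2
  have hYn : ‖hYL.toLp Y‖ = ‖Y'‖ := by
    rw [hYY.norm_toLp_eq hYL (Lp.memLp Y'), Lp.toLp_coeFn]
  have hBY : inner ℝ (hB.toLp _) (hYL.toLp Y) = inner ℝ (hB'.toLp _) Y' := by
    have hid' : IdentDistrib (fun ω ↦ ((c (r (X ω, ξ ω))).2, Y ω))
        (fun ω ↦ ((c (r (X' ω, ξ' ω))).2, Y' ω)) P P' :=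
      hid.comp (u := fun p : ℕ × EuclideanSpace ℝ (Fin d) ↦ ((c p.1).2, p.2))
        ((hc2.comp measurable_fst).prodMk measurable_snd)
    have := hid'.inner_toLp_eq hB hYL hB' (Lp.memLp Y')
    rwa [Lp.toLp_coeFn] at this
  have hAY : ‖hYL.toLp Y - hA.toLp _‖ = ‖Y' - hA'.toLp _‖ := by
    have hid' : IdentDistrib (Y - fun ω ↦ (c (r (X ω, ξ ω))).1)
        ((Y' : Ω' → _) - fun ω ↦ (c (r (X' ω, ξ' ω))).1) P P' :=
      hid.comp (u := fun p : ℕ × EuclideanSpace ℝ (Fin d) ↦ p.2 - (c p.1).1)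
        (measurable_snd.sub (hc1.comp measurable_fst))
    have := hid'.norm_toLp_eq (hYL.sub hA) ((Lp.memLp Y').sub hA')
    rwa [MemLp.toLp_sub hYL hA, MemLp.toLp_sub (Lp.memLp Y') hA', Lp.toLp_coeFn] at this
  refine ⟨hYL.toLp Y, Subtype.ext ?_, ?_, ?_⟩
  · exact (Measure.map_congr hYL.coeFn_toLp).trans hYY.map_eq
  · have h1 := norm_sub_le_norm_sub_add_norm_sub (hYL.toLp Y) (hA.toLp _) X
    have h2 := norm_sub_le_norm_sub_add_norm_sub Y' X' (hA'.toLp _)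
    rw [norm_sub_rev (hA.toLp _) X] at h1
    linarith
  · have h1 := abs_real_inner_le_norm (ξ - hB.toLp _) (hYL.toLp Y)
    have h2 := abs_real_inner_le_norm (ξ' - hB'.toLp _) Y'
    have h3 := h1.trans (mul_le_mul_of_nonneg_right hξB (norm_nonneg _))
    have h4 := h2.trans (mul_le_mul_of_nonneg_right hξB' (norm_nonneg _))
    rw [inner_sub_left, hBY, hYn] at h3
    rw [inner_sub_left] at h4
    rw [abs_le] at h3 h4 ⊢
    constructor <;> linarith

/-- Gradients of lifts transfer between random variables with the same joint law, from an atomless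
probability space to an arbitrary one. -/
theorem IsAtomless.hasGradientAt_lift_of_identDistrib [IsProbabilityMeasure P]
    [IsProbabilityMeasure P'] (hP : IsAtomless P) {f : P2 d → ℝ} {X ξ : L2 P d} {X' ξ' : L2 P' d}
    (h : IdentDistrib (fun ω ↦ (X ω, ξ ω)) (fun ω ↦ (X' ω, ξ' ω)) P P')
    (hf : HasGradientAt (lift P f) ξ X) : HasGradientAt (lift P' f) ξ' X' := by
  rw [hasGradientAt_iff_isLittleO, Asymptotics.isLittleO_iff] at hf ⊢
  intro ε hε
  obtain ⟨δ, hδ, hball⟩ := Metric.eventually_nhds_iff.1 (hf hε)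
  refine Metric.eventually_nhds_iff.2 ⟨δ, hδ, fun Y' hY' ↦ ?_⟩
  rw [dist_eq_norm] at hY'
  have hX : lift P f X = lift P' f X' :=
    congrArg f (Subtype.ext (h.comp measurable_fst).map_eq)
  have hin : inner ℝ ξ X = inner ℝ ξ' X' := by
    have := IdentDistrib.inner_toLp_eq (h.comp measurable_swap) (Lp.memLp ξ) (Lp.memLp X)
      (Lp.memLp ξ') (Lp.memLp X')
    simpa only [Lp.toLp_coeFn] using this
  -- The condition on `η` keeps the copy `Y` in the ball of radius `δ` about `X`; the extra error is
  -- `2 * η * ε` from the norm and `2 * η * ‖Y'‖` from the inner product.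
  have key : ∀ η : ℝ, 0 < η → 2 * η < δ - ‖Y' - X'‖ →
      ‖lift P' f Y' - lift P' f X' - inner ℝ ξ' (Y' - X')‖ ≤
        ε * ‖Y' - X'‖ + η * (2 * ε + 2 * ‖Y'‖) := by
    intro η hη hηδ
    obtain ⟨Y, hlaw, hle, hinner⟩ := hP.exists_approx_coupling h Y' hη
    have h1 := hball (y := Y) (by rw [dist_eq_norm]; linarith)
    have hYY : lift P f Y = lift P' f Y' := congrArg f hlaw
    have h2 := h1.trans (mul_le_mul_of_nonneg_left hle hε.le)
    rw [inner_sub_right, hX, hYY, hin, Real.norm_eq_abs] at h2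
    rw [inner_sub_right, Real.norm_eq_abs]
    rw [abs_le] at h2 hinner ⊢
    constructor <;> linarith
  have hlim : Tendsto (fun η : ℝ ↦ ε * ‖Y' - X'‖ + η * (2 * ε + 2 * ‖Y'‖)) (𝓝[>] 0)
      (𝓝 (ε * ‖Y' - X'‖)) := by
    have : Continuous fun η : ℝ ↦ ε * ‖Y' - X'‖ + η * (2 * ε + 2 * ‖Y'‖) := by fun_prop
    simpa using (this.tendsto 0).mono_left nhdsWithin_le_nhds
  refine ge_of_tendsto hlim ?_
  filter_upwards [Ioo_mem_nhdsGT (show 0 < (δ - ‖Y' - X'‖) / 2 by linarith)] with η hη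
  exact key η hη.1 (by linarith [hη.2])

end Transfer

/-! ### The gradient is a function of the variable -/

section Factorisation

/-- If two conditionally independent copies of the second variable given the first one coincide,
then the second variable is a function of the first one. -/
theorem exists_stronglyMeasurable_ae_snd_eq {α E : Type*} [MeasurableSpace α]
    [NormedAddCommGroup E] [NormedSpace ℝ E] [CompleteSpace E] [MeasurableSpace E] [BorelSpace E]
    [SecondCountableTopology E] {ν : Measure α} [IsProbabilityMeasure ν] {κ : Kernel α E}
    [IsMarkovKernel κ] (h : ∀ᵐ p ∂(ν ⊗ₘ (κ ×ₖ κ)), p.2.1 = p.2.2) :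
    ∃ g : α → E, StronglyMeasurable g ∧ ∀ᵐ p ∂(ν ⊗ₘ κ), p.2 = g p.1 := by
  -- The conditional mean serves as `g`: `κ x` is a Dirac mass for almost every `x`, so no
  -- integrability assumption is needed.
  have hg : StronglyMeasurable fun x ↦ ∫ y, y ∂κ x :=
    StronglyMeasurable.integral_kernel (f := fun y : E ↦ y) stronglyMeasurable_id
  refine ⟨_, hg, Measure.ae_compProd_of_ae_ae
    (measurableSet_eq_fun measurable_snd (hg.measurable.comp measurable_fst)) ?_⟩
  filter_upwards [Measure.ae_ae_of_ae_compProd h] with x hx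
  rw [Kernel.prod_apply] at hx
  filter_upwards [Measure.ae_ae_of_ae_prod hx] with y hy
  have : ∫ z, z ∂κ x = ∫ _, y ∂κ x := integral_congr_ae (hy.mono fun z hz ↦ hz.symm)
  simp [this]

variable {Ω : Type*} [MeasurableSpace Ω] {P : Measure Ω} [IsProbabilityMeasure P] {d : ℕ}

/-- The gradient of a lift at `X` is a function of `X`. -/
theorem IsAtomless.exists_gradient_lift_eq_comp (hP : IsAtomless P) {f : P2 d → ℝ} {X ξ : L2 P d}
    (hf : HasGradientAt (lift P f) ξ X) :
    ∃ g : EuclideanSpace ℝ (Fin d) → EuclideanSpace ℝ (Fin d),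
      StronglyMeasurable g ∧ ∀ᵐ ω ∂P, ξ ω = g (X ω) := by
  have hXξ : Measurable fun ω ↦ (X ω, ξ ω) := X.measurable.prodMk ξ.measurable
  set ρ := P.map fun ω ↦ (X ω, ξ ω) with hρ
  have : IsProbabilityMeasure ρ := Measure.isProbabilityMeasure_map hXξ.aemeasurable
  set κ := ρ.condKernel
  have hdis : ρ.fst ⊗ₘ κ = ρ := ρ.disintegrate _
  -- Under `Q`, the last two coordinates are independent copies of `ξ` given the first, and each
  -- pairs with it to the law of `(X, ξ)`.
  set Q := ρ.fst ⊗ₘ (κ ×ₖ κ) with hQ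
  have map_of : ∀ {u : EuclideanSpace ℝ (Fin d) × EuclideanSpace ℝ (Fin d) →
      EuclideanSpace ℝ (Fin d)}, Measurable u → (κ ×ₖ κ).map u = κ →
      IdentDistrib (fun ω ↦ (X ω, ξ ω)) (fun p ↦ (p.1, u p.2)) P Q := by
    intro u hu hκ
    refine ⟨hXξ.aemeasurable, by fun_prop, ?_⟩
    have := Measure.compProd_map (μ := ρ.fst) (κ := κ ×ₖ κ) hu
    rw [hκ, hdis] at this
    exact this
  have h1 := map_of measurable_fst ((Kernel.fst_eq _).symm.trans (Kernel.fst_prod κ κ))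
  have h2 := map_of measurable_snd ((Kernel.snd_eq _).symm.trans (Kernel.snd_prod κ κ))
  have hX := (h1.comp measurable_fst).memLp_snd (Lp.memLp X)
  have hξ1 := (h1.comp measurable_snd).memLp_snd (Lp.memLp ξ)
  have hξ2 := (h2.comp measurable_snd).memLp_snd (Lp.memLp ξ)
  have grad : ∀ {v : EuclideanSpace ℝ (Fin d) × EuclideanSpace ℝ (Fin d) ×
      EuclideanSpace ℝ (Fin d) → EuclideanSpace ℝ (Fin d)} (hv : MemLp v 2 Q),
      IdentDistrib (fun ω ↦ (X ω, ξ ω)) (fun p ↦ (p.1, v p)) P Q →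
      HasGradientAt (lift Q f) (hv.toLp v) (hX.toLp _) := by
    intro v hv h
    refine hP.hasGradientAt_lift_of_identDistrib (h.trans (IdentDistrib.of_ae_eq h.aemeasurable_snd
      ?_)) hf
    filter_upwards [hX.coeFn_toLp, hv.coeFn_toLp] with p hp hp'
    rw [hp, hp']
    rfl
  have heq := (grad hξ1 h1).unique (grad hξ2 h2)
  have hae : ∀ᵐ p ∂Q, p.2.1 = p.2.2 := (MemLp.toLp_eq_toLp_iff hξ1 hξ2).1 heq
  obtain ⟨g, hg, hgρ⟩ := exists_stronglyMeasurable_ae_snd_eq hae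
  rw [hdis] at hgρ
  exact ⟨g, hg, ae_of_ae_map hXξ.aemeasurable hgρ⟩

end Factorisation

/-! ### Independence of the probability space -/

section Main

variable {Ω : Type*} [MeasurableSpace Ω] {P : Measure Ω} [IsProbabilityMeasure P]
  {Ω' : Type*} [MeasurableSpace Ω'] {P' : Measure Ω'} [IsProbabilityMeasure P'] {d : ℕ}
  {f : P2 d → ℝ} {μ : P2 d}

theorem identDistrib_prodMk_compMeasurePreserving {X : L2 P d} (hX : law P X = μ) (g : L2 μ.1 d) :
    IdentDistrib (fun x ↦ (x, g x))
      (fun ω ↦ (X ω, Lp.compMeasurePreserving X (measurePreserving_of_law_eq hX) g ω)) μ.1 P := by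
  have hmp := measurePreserving_of_law_eq hX
  have hm : Measurable fun x ↦ (x, g x) := measurable_id.prodMk g.measurable
  refine IdentDistrib.symm ⟨(X.measurable.prodMk (L2.measurable _)).aemeasurable,
    hm.aemeasurable, ?_⟩
  have h1 := Measure.map_map (μ := P) hm X.measurable
  rw [hmp.map_eq] at h1
  refine (Measure.map_congr ?_).trans h1.symm
  filter_upwards [Lp.coeFn_compMeasurePreserving g hmp] with ω hω
  rw [hω]
  rfl

/-- Both `(X, g(X))` and `(X', g(X'))` have the law of `(x, g x)` under `μ`. The case `P' = P` is
included and handles the other variables of law `μ` on the original space. -/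
theorem IsAtomless.isLDerivativeAt (hP : IsAtomless P) {X : L2 P d} (hX : law P X = μ)
    {g : L2 μ.1 d} (hf : HasGradientAt (lift P f)
      (Lp.compMeasurePreserving X (measurePreserving_of_law_eq hX) g) X) :
    IsLDerivativeAt P' f μ g := fun _ hX' ↦
  hP.hasGradientAt_lift_of_identDistrib ((identDistrib_prodMk_compMeasurePreserving hX g).symm.trans
    (identDistrib_prodMk_compMeasurePreserving hX' g)) hf

theorem LDifferentiableAt.exists_hasGradientAt (hP : IsAtomless P) (hf : LDifferentiableAt P f μ) :
    ∃ (X : L2 P d) (hX : law P X = μ) (g : L2 μ.1 d), HasGradientAt (lift P f)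
      (Lp.compMeasurePreserving X (measurePreserving_of_law_eq hX) g) X := by
  obtain ⟨X, hX, hdiff⟩ := hf
  have hgrad := hdiff.hasGradientAt
  have hmp := measurePreserving_of_law_eq hX
  obtain ⟨g, hg, hgX⟩ := hP.exists_gradient_lift_eq_comp hgrad
  have hL : MemLp g 2 μ.1 := by
    rw [← hmp.map_eq, memLp_map_measure_iff hg.aestronglyMeasurable X.measurable.aemeasurable]
    exact (Lp.memLp _).ae_eq hgX
  refine ⟨X, hX, hL.toLp g, ?_⟩
  convert hgrad using 1
  refine Lp.ext ?_
  filter_upwards [Lp.coeFn_compMeasurePreserving (hL.toLp g) hmp, hgX,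
    hmp.quasiMeasurePreserving.ae hL.coeFn_toLp] with ω h1 h2 h3
  rw [h1, h2, ← h3]
  rfl

/-- An atomless probability space carries every law of `𝒫₂(ℝᵈ)`. -/
theorem IsAtomless.exists_law_eq (hP : IsAtomless P) (μ : P2 d) : ∃ X : L2 P d, law P X = μ := by
  have := μ.2.1
  obtain ⟨U, hU, hU0⟩ := hP.exists_measurable_real
  obtain ⟨Y, hY, hYμ⟩ :=
    exists_measurable_map_eq_of_measure_preimage_singleton_eq_zero P hU hU0 μ.1
  have hid : MemLp (fun x : EuclideanSpace ℝ (Fin d) ↦ x) 2 μ.1 := by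
    refine ⟨by fun_prop, ?_⟩
    rw [eLpNorm_lt_top_iff_lintegral_rpow_enorm_lt_top (by norm_num) (by norm_num)]
    simpa using μ.2.2
  have hL : MemLp Y 2 P := by
    rw [← hYμ, memLp_map_measure_iff (by fun_prop) hY.aemeasurable] at hid
    exact hid
  exact ⟨hL.toLp Y, Subtype.ext ((Measure.map_congr hL.coeFn_toLp).trans hYμ)⟩

/-- Atomlessness of the target serves only to provide some variable of law `μ`. -/
theorem LDifferentiableAt.of_isAtomless (hP : IsAtomless P) (hP' : IsAtomless P')
    (hf : LDifferentiableAt P f μ) : LDifferentiableAt P' f μ := by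
  obtain ⟨X, hX, g, hg⟩ := hf.exists_hasGradientAt hP
  obtain ⟨X', hX'⟩ := hP'.exists_law_eq μ
  exact ⟨X', hX', (hP.isLDerivativeAt (P' := P') hX hg X' hX').hasFDerivAt.differentiableAt⟩

end Main

theorem proposition5
    {Ω : Type*} [MeasurableSpace Ω] (P : Measure Ω) [IsProbabilityMeasure P] (hP : IsAtomless P)
    {Ω' : Type*} [MeasurableSpace Ω'] (P' : Measure Ω') [IsProbabilityMeasure P']
    (hP' : IsAtomless P')
    (d : ℕ) (f : P2 d → ℝ) (μ : P2 d) :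
    (LDifferentiableAt P f μ ↔ LDifferentiableAt P' f μ) ∧
    (LDifferentiableAt P f μ →
      ∃ g : L2 μ.1 d, IsLDerivativeAt P f μ g ∧ IsLDerivativeAt P' f μ g) := by
  refine ⟨⟨.of_isAtomless hP hP', .of_isAtomless hP' hP⟩, fun hf ↦ ?_⟩
  obtain ⟨X, hX, g, hg⟩ := hf.exists_hasGradientAt hP
  exact ⟨g, hP.isLDerivativeAt hX hg, hP.isLDerivativeAt hX hg⟩
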